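/- Let $n\ge 4$, let $K_n$ be the complete graph on $n$ vertices, and let $\mathbf U_{K_n}=[U_{ef}]$ be its Grover matrix, indexed by the $n(n-1)$ oriented edges: $U_{ef}=\frac{2}{\deg t(f)}$ if $t(f)=o(e)$ and $f\neq e^{-1}$, $U_{ef}=\frac{2}{\deg t(f)}-1$ if $f=e^{-1}$, and $U_{ef}=0$ otherwise, where $o(e)$ and $t(e)$ are the origin and the terminus of $e$ and $e^{-1}$ is $e$ reversed. Let $\zeta_{\mathbf U_{K_n}}(u)=\det(\mathbf I-u\,\mathbf U_{K_n})^{-1}$, and put $$L=\frac{n(n-3)}2,\qquad M=\frac{n^2-n+2}2=L+n+1,\qquad P_l=\sum_{i=0}^{\lfloor l/2\rfloor}(-1)^{l-i}\binom{l-i}{i}\Bigl(\frac2{n-1}\Bigr)^{l-2i}\quad(l\ge 0).$$ For $\mathbf k=(k_1,\dots,k_M)\in\mathbb Z_{\ge0}^M$ put $$a(\mathbf k)=\prod_{N=L+3}^{M}P_{k_N},\qquad c(\mathbf k)=(k_1+k_2+2)+\sum_{m=3}^{L+2}(2k_m+2)+\sum_{N=L+3}^{M}(k_N+2).$$ (1)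 As rational functions of $u$, $$\zeta_{\mathbf U_{K_n}}(u)=(-1)^L\,\frac1{(u-1)^{2}}\,\frac1{(u^2-1)^{L}}\,\Bigl(u^2+\frac{2}{n-1}u+1\Bigr)^{-(n-1)}.$$ Now let $f=\zeta_{\mathbf U_{K_n}}$ and let $s\in\mathbb C$ with $\operatorname{Re}s>-n(n-1)$. (2) For every $w\in\mathbb C$ with $\operatorname{Re}w>M$, the integral defining the absolute Hurwitz zeta function $Z_f(w,s)=\frac1{\Gamma(w)}\int_1^\infty f(x)\,x^{-s-1}(\log x)^{w-1}\,dx$ converges absolutely, the series below converges absolutely, and $$Z_f(w,s)=(-1)^L\sum_{\mathbf k\ge0}\frac{a(\mathbf k)}{(c(\mathbf k)+s)^{w}}.$$ (3) The function $w\mapsto Z_f(w,s)$, given for $\operatorname{Re}w$ large, has a meromorphic continuation to a half-plane containing $0$ that is holomorphic at $w=0$, and the absolute zeta function $\zeta_f(s)=\exp\bigl(\frac{\partial}{\partial w}Z_f(w,s)\big|_{w=0}\bigr)$, the derivative being that of the continuation, is the zeta-regularized infinite product $$\zeta_f(s)=\prod_{\mathbf k\ge0}\bigl(c(\mathbf k)+s\bigr)^{-(-1)^{L}a(\mathbf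 k)},$$ where $\prod_{\mathbf k}\lambda_{\mathbf k}^{b_{\mathbf k}}$ stands for $\exp\bigl(-\frac{\partial}{\partial w}\sum_{\mathbf k}b_{\mathbf k}\lambda_{\mathbf k}^{-w}\big|_{w=0}\bigr)$, with the analytic continuation of the series. -/

import Mathlib

/-- The matrix `[U_{ef}]` of the Grover walk (flip-flop type) on `G`, indexed by the oriented edges
of `G`; for a dart `e`, `e.fst = o(e)`, `e.snd = t(e)` and `e.symm = e⁻¹`. -/
noncomputable def groverMatrix {V : Type*} [Fintype V] [DecidableEq V] (G : SimpleGraph V)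
    [DecidableRel G.Adj] : Matrix G.Dart G.Dart ℝ :=
  Matrix.of fun e f =>
    if f.snd = e.fst ∧ f ≠ e.symm then 2 / (G.degree f.snd : ℝ)
    else if f = e.symm then 2 / (G.degree f.snd : ℝ) - 1
    else 0

/-- The zeta function `ζ_A(u) = det(I - u A)⁻¹` of a square matrix. -/
noncomputable def matrixZeta {N : Type*} [Fintype N] [DecidableEq N] (A : Matrix N N ℂ) (u : ℂ) :
    ℂ :=
  (Matrix.det (1 - u • A))⁻¹

/-- The zeta function `ζ_{U_G}` of the Grover walk on `G`. -/
noncomputable def groverZeta {V : Type*} [Fintype V] [DecidableEq V] (G : SimpleGraph V)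
    [DecidableRel G.Adj] (u : ℂ) : ℂ :=
  matrixZeta ((groverMatrix G).map (fun x : ℝ => (x : ℂ))) u

/-- The integrand `f(x) x^{-s-1} (log x)^{w-1}` of the absolute Hurwitz zeta function. -/
noncomputable def absoluteHurwitzIntegrand (f : ℝ → ℂ) (w s : ℂ) (x : ℝ) : ℂ :=
  f x * (x : ℂ) ^ (-s - 1) * (Real.log x : ℂ) ^ (w - 1)

/-- The absolute Hurwitz zeta function
`Z_f(w,s) = Γ(w)⁻¹ ∫_1^∞ f(x) x^{-s-1} (log x)^{w-1} dx`. -/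
noncomputable def absoluteHurwitzZeta (f : ℝ → ℂ) (w s : ℂ) : ℂ :=
  1 / Complex.Gamma w * ∫ x in Set.Ioi (1 : ℝ), absoluteHurwitzIntegrand f w s x

/-- `Φ` is an analytic continuation to the point `0` of the function that `F` gives on some right
half-plane: `Φ` agrees with `F` for `Re w` large, is meromorphic on a half-plane containing `0`,
and is holomorphic at `0`. -/
structure ContinuesToZero (F Φ : ℂ → ℂ) : Prop where
  eq_right : ∃ σ : ℝ, ∀ w : ℂ, σ < w.re → Φ w = F w
  meromorphic : ∃ ε : ℝ, 0 < ε ∧ MeromorphicOn Φ {w : ℂ | -ε < w.re}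
  analyticAt_zero : AnalyticAt ℂ Φ 0

/-- The germ at `0` of the continuation does not depend on the continuation. -/
theorem ContinuesToZero.eventuallyEq {F Φ Ψ : ℂ → ℂ} (h₁ : ContinuesToZero F Φ)
    (h₂ : ContinuesToZero F Ψ) : Φ =ᶠ[nhds 0] Ψ := by
  obtain ⟨σ₁, hσ₁⟩ := h₁.eq_right
  obtain ⟨σ₂, hσ₂⟩ := h₂.eq_right
  obtain ⟨ε₁, hε₁, hm₁⟩ := h₁.meromorphic
  obtain ⟨ε₂, hε₂, hm₂⟩ := h₂.meromorphic
  have hmin : 0 < min ε₁ ε₂ := lt_min hε₁ hε₂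
  set U : Set ℂ := {w : ℂ | -(min ε₁ ε₂) < w.re} with hU
  have hmer : MeromorphicOn (Φ - Ψ) U := by
    refine MeromorphicOn.sub (fun w hw => hm₁ w ?_) (fun w hw => hm₂ w ?_)
    · exact lt_of_le_of_lt (neg_le_neg (min_le_left _ _)) (show -(min ε₁ ε₂) < w.re from hw)
    · exact lt_of_le_of_lt (neg_le_neg (min_le_right _ _)) (show -(min ε₁ ε₂) < w.re from hw)
  have hpre : IsPreconnected U := (convex_halfSpace_re_gt _).isPreconnected
  have h0 : (0 : ℂ) ∈ U := by simp [hU, hε₁, hε₂]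
  set τ : ℝ := max 0 (max σ₁ σ₂) + 1 with hτ
  have hτ0 : 0 < τ := by
    have := le_max_left (0 : ℝ) (max σ₁ σ₂)
    linarith
  have hτ1 : max σ₁ σ₂ < τ := by
    have := le_max_right (0 : ℝ) (max σ₁ σ₂)
    linarith
  have hτU : (τ : ℂ) ∈ U := by
    change -(min ε₁ ε₂) < (τ : ℂ).re
    rw [Complex.ofReal_re]
    linarith
  have htop : meromorphicOrderAt (Φ - Ψ) (τ : ℂ) = ⊤ := by
    rw [meromorphicOrderAt_eq_top_iff]
    have hopen : IsOpen {w : ℂ | max σ₁ σ₂ < w.re} :=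
      isOpen_lt continuous_const Complex.continuous_re
    have hmem : {w : ℂ | max σ₁ σ₂ < w.re} ∈ nhds (τ : ℂ) :=
      hopen.mem_nhds (by simpa using hτ1)
    filter_upwards [nhdsWithin_le_nhds hmem] with w hw
    have hw' : max σ₁ σ₂ < w.re := hw
    rw [Pi.sub_apply, hσ₁ w (lt_of_le_of_lt (le_max_left _ _) hw'),
      hσ₂ w (lt_of_le_of_lt (le_max_right _ _) hw'), sub_self]
  have hz : meromorphicOrderAt (Φ - Ψ) 0 = ⊤ := by
    by_contra hne
    exact hmer.meromorphicOrderAt_ne_top_of_isPreconnected hpre h0 hτU hne htop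
  rw [meromorphicOrderAt_eq_top_iff] at hz
  rw [Filter.EventuallyEq,
    ← h₁.analyticAt_zero.frequently_eq_iff_eventually_eq h₂.analyticAt_zero]
  exact (hz.mono fun w hw => sub_eq_zero.mp hw).frequently

open Classical in
/-- The derivative at `w = 0` of the analytic continuation of `F` (and `0` if there is no
continuation). -/
noncomputable def continuedDerivAtZero (F : ℂ → ℂ) : ℂ :=
  if h : ∃ Φ : ℂ → ℂ, ContinuesToZero F Φ then deriv h.choose 0 else 0

theorem ContinuesToZero.continuedDerivAtZero_eq {F Φ : ℂ → ℂ} (h : ContinuesToZero F Φ) :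
    continuedDerivAtZero F = deriv Φ 0 := by
  have h' : ∃ Φ : ℂ → ℂ, ContinuesToZero F Φ := ⟨Φ, h⟩
  rw [continuedDerivAtZero, dif_pos h']
  exact (h'.choose_spec.eventuallyEq h).deriv_eq

/-- The absolute zeta function `ζ_f(s) = exp(∂/∂w Z_f(w,s) |_{w=0})`. -/
noncomputable def absoluteZeta (f : ℝ → ℂ) (s : ℂ) : ℂ :=
  Complex.exp (continuedDerivAtZero fun w => absoluteHurwitzZeta f w s)

/-- The zeta-regularized infinite product `∏_k (lam k)^{a k}`, that is,
`exp(-∂/∂w ∑_k (a k) (lam k)^{-w} |_{w=0})`, the derivative being that of the analytic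
continuation of the Dirichlet series. -/
noncomputable def zetaRegularizedProd {ι : Type*} (lam a : ι → ℂ) : ℂ :=
  Complex.exp (-continuedDerivAtZero fun w => ∑' k, a k * lam k ^ (-w))

/-- `L = n(n-3)/2`. -/
def completeL (n : ℕ) : ℕ := n * (n - 3) / 2

/-- `M = (n² - n + 2)/2 = 2 + L + (n - 1)`. -/
def completeM (n : ℕ) : ℕ := (n ^ 2 - n + 2) / 2

/-- `P_l = ∑_{i=0}^{⌊l/2⌋} (-1)^{l-i} C(l-i,i) (2/(n-1))^{l-2i}`. -/
noncomputable def completeP (n l : ℕ) : ℝ :=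
  ∑ i ∈ Finset.range (l / 2 + 1),
    (-1) ^ (l - i) * ((l - i).choose i : ℝ) * (2 / ((n : ℝ) - 1)) ^ (l - 2 * i)

/-- The product of the `P_{k_N}` over the last `n - 1` indices (those with `L + 3 ≤ N ≤ M` when
counted from `1`). -/
noncomputable def completeCoeff (n : ℕ) (k : Fin (completeM n) → ℕ) : ℝ :=
  ∏ N with completeL n + 2 ≤ (N : Fin (completeM n)).val, completeP n (k N)

/-- `(k_1 + k_2 + 2) + ∑_m (2 k_m + 2) + ∑_N (k_N + 2)`, where `3 ≤ m ≤ L + 2` and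
`L + 3 ≤ N ≤ M` (indices counted from `1`). -/
def completeExponent (n : ℕ) (k : Fin (completeM n) → ℕ) : ℕ :=
  (∑ j with (j : Fin (completeM n)).val < 2, (k j + 1))
    + (∑ m with 2 ≤ (m : Fin (completeM n)).val ∧ m.val < completeL n + 2, (2 * k m + 2))
    + (∑ N with completeL n + 2 ≤ (N : Fin (completeM n)).val, (k N + 2))

/-! For a `d`-regular graph, `U = (2/d) S T - J`, where `J` reverses oriented edges and `S`, `T` are
the origin and terminus incidence matrices. Since `J² = 1`, the factor `1 + uJ` can be pulled out of
`1 - uU`, and `det(1 - AB) = det(1 - BA)` moves the rest to the vertices, where `T(1 - uJ)S = A -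
uD`, with `A` the adjacency matrix and `D` the degree matrix. For `K_n` the vertex matrix is a
scalar matrix plus one of rank one, which gives (1).

Put `y = u⁻¹ = e^{-t}`, with `t = log x`. Each factor of the zeta function becomes a power series in
`y`, and the `P_l` are the coefficients of `1/(1 + ay + y²)` with `a = 2/(n-1)`. Multiplying out
gives `f = (-1)^L ∑ a(k) y^{c(k)}`, and Euler's integral turns each term into `Γ(w) a(k)
(c(k)+s)^{-w}`. Two facts allow termwise integration for `Re w > M`: the `P_l` are bounded, and `Re
(c(k)+s)` grows at least linearly in `∑ k_j`.

For (3), the integral is a Mellin transform of a function meromorphic at `t = 0` and exponentially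
small at infinity. Subtracting its singular part continues the transform beyond `w = 0`, with at
most a simple pole there, which the zero of `1/Γ` cancels. The regularized product comes from the
same function up to sign, and the germ of a continuation at `0` is unique. -/

namespace SimpleGraph

/-! ### Incidence matrices of oriented edges and their products -/

section Flip

variable {V : Type*} [Fintype V] [DecidableEq V] (G : SimpleGraph V) [DecidableRel G.Adj]

/-- The matrix of the reversal of oriented edges. -/
def flipMatrix (R : Type*) [Zero R] [One R] : Matrix G.Dart G.Dart R :=
  Matrix.of fun e f => if f = e.symm then 1 else 0

/-- The incidence matrix of oriented edges and their origins. -/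
def originMatrix (R : Type*) [Zero R] [One R] : Matrix G.Dart V R :=
  Matrix.of fun e v => if e.fst = v then 1 else 0

/-- The incidence matrix of termini and oriented edges. -/
def terminusMatrix (R : Type*) [Zero R] [One R] : Matrix V G.Dart R :=
  Matrix.of fun v e => if e.snd = v then 1 else 0

variable (R : Type*) [CommRing R]

theorem flipMatrix_mul {n : Type*} (B : Matrix G.Dart n R) :
    G.flipMatrix R * B = Matrix.of fun e f => B e.symm f := by
  ext e f
  simp [flipMatrix, Matrix.mul_apply]

theorem flipMatrix_mul_self : G.flipMatrix R * G.flipMatrix R = 1 := by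
  rw [flipMatrix_mul]
  ext e f
  simp [flipMatrix, Matrix.one_apply, eq_comm]

theorem terminusMatrix_mul_originMatrix :
    G.terminusMatrix R * G.originMatrix R = G.adjMatrix R := by
  ext v w
  rw [Matrix.mul_apply, adjMatrix_apply]
  simp only [terminusMatrix, originMatrix, Matrix.of_apply]
  by_cases h : G.Adj v w
  · rw [if_pos h, Finset.sum_eq_single (⟨(w, v), h.symm⟩ : G.Dart)]
    · simp
    · rintro ⟨⟨a, b⟩, hab⟩ - hne
      by_cases h1 : b = v
      · by_cases h2 : a = w
        · subst h1 h2
          exact absurd rfl hne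
        · simp [h2]
      · simp [h1]
    · simp
  · rw [if_neg h]
    refine Finset.sum_eq_zero ?_
    rintro ⟨⟨a, b⟩, hab⟩ -
    by_cases h1 : b = v
    · by_cases h2 : a = w
      · subst h1 h2
        exact absurd hab.symm h
      · simp [h2]
    · simp [h1]

theorem terminusMatrix_mul_flipMatrix_mul_originMatrix :
    G.terminusMatrix R * (G.flipMatrix R * G.originMatrix R) =
      Matrix.diagonal fun v => (G.degree v : R) := by
  rw [flipMatrix_mul]
  ext v w
  rw [Matrix.mul_apply, Matrix.diagonal_apply]
  simp only [terminusMatrix, originMatrix, Matrix.of_apply]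
  by_cases h : v = w
  · subst h
    rw [if_pos rfl, ← G.dart_fst_fiber_card_eq_degree v, Finset.card_filter, Nat.cast_sum,
      ← Equiv.sum_comp (Function.Involutive.toPerm _ (Dart.symm_involutive (G := G)))]
    refine Finset.sum_congr rfl fun e _ => ?_
    by_cases he : e.fst = v <;> simp [he, Dart.symm]
  · rw [if_neg h]
    refine Finset.sum_eq_zero fun e _ => ?_
    by_cases h1 : e.snd = v
    · have : e.snd ≠ w := h1 ▸ h
      simp [Dart.symm, this]
    · simp [h1]

theorem one_add_smul_flipMatrix_mul (x : R) :
    (1 + x • G.flipMatrix R) * (1 - x • G.flipMatrix R) = (1 - x ^ 2) • 1 := by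
  rw [add_mul, mul_sub, mul_one, one_mul, mul_sub, mul_one, smul_mul_smul_comm,
    flipMatrix_mul_self, sub_smul, one_smul, sq]
  abel

end Flip

/-! ### Reduction of the Grover determinant to the vertices -/

section Det

variable {V : Type*} [Fintype V] [LinearOrder V] (G : SimpleGraph V) [DecidableRel G.Adj]

/-- Orient each edge by the order on `V`. The diagonal matrix of the resulting signs anticommutes
with the flip, so it conjugates `1 + xJ` to `1 - xJ`. The two determinants agree, and their product
is known from `J² = 1`. -/
theorem det_one_add_smul_flipMatrix_sq {R : Type*} [CommRing R] (x : R) :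
    (1 + x • G.flipMatrix R).det ^ 2 = ((1 - x ^ 2) ^ G.edgeFinset.card) ^ 2 := by
  let D : Matrix G.Dart G.Dart R := Matrix.diagonal fun e => if e.fst < e.snd then 1 else -1
  have hD : D * D = 1 := by
    rw [Matrix.diagonal_mul_diagonal, ← Matrix.diagonal_one]
    congr 1
    ext e
    split_ifs <;> simp
  have hDJ : D * G.flipMatrix R = -(G.flipMatrix R * D) := by
    ext e f
    rw [Matrix.neg_apply, Matrix.diagonal_mul, Matrix.mul_diagonal]
    simp only [flipMatrix, Matrix.of_apply]
    by_cases h : f = e.symm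
    · subst h
      rcases lt_or_gt_of_ne e.fst_ne_snd with h | h
      · simp [Dart.symm, h, h.not_gt]
      · simp [Dart.symm, h, h.not_gt]
    · simp [h]
  have hconj : D * (1 + x • G.flipMatrix R) * D = 1 - x • G.flipMatrix R := by
    rw [mul_add, mul_one, add_mul, hD, Matrix.mul_smul, hDJ, Matrix.smul_mul, neg_mul, mul_assoc,
      hD, mul_one, smul_neg, sub_eq_add_neg]
  have hdet : (1 - x • G.flipMatrix R).det = (1 + x • G.flipMatrix R).det := by
    rw [← hconj, Matrix.det_mul, Matrix.det_mul, mul_right_comm, ← Matrix.det_mul, hD,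
      Matrix.det_one, one_mul]
  calc (1 + x • G.flipMatrix R).det ^ 2
      = ((1 + x • G.flipMatrix R) * (1 - x • G.flipMatrix R)).det := by
        rw [Matrix.det_mul, hdet, sq]
    _ = _ := by
        rw [one_add_smul_flipMatrix_mul, Matrix.det_smul, Matrix.det_one, mul_one,
          dart_card_eq_twice_card_edges, ← pow_mul, mul_comm]

/-- The squares determine the value up to sign. Taking `x` to be an indeterminate makes the sign the
same for all `x`, and the value `1` at `x = 0` settles it because `2 ≠ 0`. -/
theorem det_one_add_smul_flipMatrix {R : Type*} [CommRing R] [IsDomain R] [NeZero (2 : R)] (x : R) :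
    (1 + x • G.flipMatrix R).det = (1 - x ^ 2) ^ G.edgeFinset.card := by
  have key : (1 + (Polynomial.X : Polynomial R) • G.flipMatrix (Polynomial R)).det =
      (1 - Polynomial.X ^ 2) ^ G.edgeFinset.card := by
    rcases sq_eq_sq_iff_eq_or_eq_neg.mp
      (G.det_one_add_smul_flipMatrix_sq (Polynomial.X : Polynomial R)) with h | h
    · exact h
    · exfalso
      have := congrArg (Polynomial.eval 0) h
      rw [← Polynomial.coe_evalRingHom, RingHom.map_det] at this
      have h1 : (Polynomial.evalRingHom (0 : R)).mapMatrix
          (1 + (Polynomial.X : Polynomial R) • G.flipMatrix (Polynomial R)) = 1 := by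
        ext e f
        simp [Matrix.one_apply, apply_ite]
      rw [h1, Matrix.det_one] at this
      simp only [Polynomial.coe_evalRingHom, Polynomial.eval_neg, Polynomial.eval_pow,
        Polynomial.eval_sub, Polynomial.eval_one, Polynomial.eval_X] at this
      simp only [ne_eq, OfNat.ofNat_ne_zero, not_false_eq_true, zero_pow, sub_zero, one_pow] at this
      have h2 : (2 : R) = 0 := by
        rw [← one_add_one_eq_two]
        nth_rewrite 1 [this]
        simp
      exact NeZero.ne (2 : R) h2
  have := congrArg (Polynomial.evalRingHom x) key
  rw [RingHom.map_det] at this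
  simp only [map_pow, map_sub, map_one, Polynomial.coe_evalRingHom, Polynomial.eval_X] at this
  rw [← this]
  congr 1
  ext e f
  simp only [flipMatrix, Matrix.add_apply, Matrix.one_apply, Matrix.smul_apply, Matrix.of_apply,
    RingHom.mapMatrix_apply, Matrix.map_apply, smul_eq_mul, Polynomial.coe_evalRingHom,
    Polynomial.eval_add, Polynomial.eval_mul, Polynomial.eval_X]
  split_ifs <;> simp

theorem one_sub_smul_groverMatrix {d : ℕ} (hG : G.IsRegularOfDegree d) (u : ℂ) :
    1 - u • (groverMatrix G).map (fun x : ℝ => (x : ℂ)) =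
      (1 + u • G.flipMatrix ℂ) - ((2 / d * u : ℂ) • G.originMatrix ℂ) * G.terminusMatrix ℂ := by
  ext e f
  have h1 : ((G.originMatrix ℂ) * G.terminusMatrix ℂ) e f = if f.snd = e.fst then 1 else 0 := by
    simp [Matrix.mul_apply, originMatrix, terminusMatrix, eq_comm]
  simp only [Matrix.sub_apply, Matrix.add_apply, Matrix.smul_mul, Matrix.smul_apply, h1,
    Matrix.map_apply, groverMatrix, flipMatrix, Matrix.of_apply, hG.degree_eq, smul_eq_mul]
  by_cases hf : f = e.symm
  · have : f.snd = e.fst := by rw [hf]; rfl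
    simp [hf, Dart.symm]
    ring
  · by_cases h2 : f.snd = e.fst
    · simp [hf, h2]
      ring
    · simp [hf, h2]

/-- An Ihara–Bass formula: for `u² ≠ 1` the inverse of `1 + uJ` is `(1 - u²)⁻¹ (1 - uJ)`, so this
factor splits off and the remaining low-rank perturbation of `1` is transferred to `V`. -/
theorem det_one_sub_smul_groverMatrix {d : ℕ} (hG : G.IsRegularOfDegree d) (hd : d ≠ 0) {u : ℂ}
    (hu : u ^ 2 ≠ 1) :
    (1 - u • (groverMatrix G).map (fun x : ℝ => (x : ℂ))).det =
      (1 - u ^ 2) ^ G.edgeFinset.card *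
        ((1 - u ^ 2)⁻¹ • ((1 + u ^ 2) • (1 : Matrix V V ℂ) - (2 / d * u : ℂ) • G.adjMatrix ℂ)).det := by
  have hu' : 1 - u ^ 2 ≠ 0 := sub_ne_zero.mpr hu.symm
  have hd' : (d : ℂ) ≠ 0 := Nat.cast_ne_zero.mpr hd
  have hfac : 1 - u • (groverMatrix G).map (fun x : ℝ => (x : ℂ)) =
      (1 + u • G.flipMatrix ℂ) * (1 - (((1 - u ^ 2)⁻¹ * (2 / d * u) : ℂ) •
        ((1 - u • G.flipMatrix ℂ) * G.originMatrix ℂ)) * G.terminusMatrix ℂ) := by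
    rw [G.one_sub_smul_groverMatrix hG, Matrix.mul_sub, Matrix.mul_one, ← Matrix.mul_assoc,
      Matrix.mul_smul, ← Matrix.mul_assoc (1 + u • G.flipMatrix ℂ), one_add_smul_flipMatrix_mul,
      Matrix.smul_mul _ 1, Matrix.one_mul, smul_smul]
    congr 3
    field_simp
  rw [hfac, Matrix.det_mul, det_one_add_smul_flipMatrix, Matrix.det_one_sub_mul_comm]
  congr 2
  rw [Matrix.mul_smul, Matrix.sub_mul, Matrix.one_mul, Matrix.mul_sub, Matrix.smul_mul,
    Matrix.mul_smul,
    terminusMatrix_mul_originMatrix, terminusMatrix_mul_flipMatrix_mul_originMatrix]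
  ext v w
  simp only [Matrix.sub_apply, Matrix.smul_apply, Matrix.one_apply, Matrix.diagonal_apply,
    hG.degree_eq, smul_eq_mul]
  split_ifs
  · field_simp
    ring
  · field_simp
    ring

end Det

/-! ### The determinant for the complete graph -/

section Complete

/-- The adjacency matrix is the all-ones matrix minus `1`, so the determinant is the characteristic
polynomial of a rank-one matrix evaluated at `a + b`. -/
theorem det_smul_one_sub_smul_adjMatrix_top {R : Type*} [Field R] {n : ℕ} (hn : n ≠ 0) (a b : R) :
    (a • (1 : Matrix (Fin n) (Fin n) R) - b • (⊤ : SimpleGraph (Fin n)).adjMatrix R).det =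
      (a + b) ^ (n - 1) * (a + b - n * b) := by
  have h : a • (1 : Matrix (Fin n) (Fin n) R) - b • (⊤ : SimpleGraph (Fin n)).adjMatrix R =
      Matrix.scalar (Fin n) (a + b) - Matrix.vecMulVec (fun _ => b) (fun _ => 1) := by
    ext v w
    by_cases h : v = w
    · simp [h, Matrix.vecMulVec_apply]
    · simp [h, Matrix.vecMulVec_apply]
  rw [h, ← Matrix.eval_charpoly, Matrix.charpoly_vecMulVec]
  obtain ⟨m, rfl⟩ := Nat.exists_eq_succ_of_ne_zero hn
  simp [dotProduct]
  ring

theorem completeL_add (n : ℕ) (hn : 4 ≤ n) :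
    completeL n + n = (⊤ : SimpleGraph (Fin n)).edgeFinset.card := by
  rw [card_edgeFinset_top_eq_card_choose_two, Fintype.card_fin, completeL, Nat.choose_two_right]
  obtain ⟨m, rfl⟩ := Nat.exists_eq_add_of_le hn
  have h : (4 + m) * (4 + m - 1) = (4 + m) * (4 + m - 3) + (4 + m) * 2 := by
    rw [← mul_add]
    congr 1
    omega
  rw [h, Nat.add_mul_div_right _ _ two_pos]

theorem det_one_sub_smul_groverMatrix_top {n : ℕ} (hn : 4 ≤ n) (u : ℂ) :
    (1 - u • (groverMatrix (⊤ : SimpleGraph (Fin n))).map (fun x : ℝ => (x : ℂ))).det =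
      (1 - u ^ 2) ^ completeL n * (1 - u) ^ 2 * (u ^ 2 + 2 / ((n : ℂ) - 1) * u + 1) ^ (n - 1) := by
  -- The factorization needs `u² ≠ 1`; both sides are continuous, so density recovers `u = ±1`.
  have hdense : Dense {u : ℂ | u ^ 2 ≠ 1} := by
    have : {u : ℂ | u ^ 2 ≠ 1} = ({1, -1} : Set ℂ)ᶜ := by
      ext u
      simp
    rw [this]
    exact (Set.toFinite _).countable.dense_compl ℂ
  refine congrFun (Continuous.ext_on (f := fun u : ℂ =>
      (1 - u • (groverMatrix (⊤ : SimpleGraph (Fin n))).map (fun x : ℝ => (x : ℂ))).det)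
    (g := fun u => (1 - u ^ 2) ^ completeL n * (1 - u) ^ 2 *
      (u ^ 2 + 2 / ((n : ℂ) - 1) * u + 1) ^ (n - 1)) hdense ?_ (by fun_prop) fun u hu => ?_) u
  · exact Continuous.matrix_det (by fun_prop)
  beta_reduce
  have hreg : (⊤ : SimpleGraph (Fin n)).IsRegularOfDegree (n - 1) := by
    intro v
    simp
  have hu' : 1 - u ^ 2 ≠ 0 := sub_ne_zero.mpr (Ne.symm hu)
  have hn1 : (n : ℂ) - 1 ≠ 0 := by
    rw [sub_ne_zero]
    exact_mod_cast (by omega : n ≠ 1)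
  rw [det_one_sub_smul_groverMatrix _ hreg (by omega) hu, Matrix.det_smul,
    det_smul_one_sub_smul_adjMatrix_top (by omega), ← completeL_add n hn, Fintype.card_fin,
    Nat.cast_sub (by omega), Nat.cast_one, pow_add, inv_pow]
  -- The eigenvalue on constant vectors, source of the double pole at `u = 1`.
  have h : 1 + u ^ 2 + 2 / ((n : ℂ) - 1) * u - n * (2 / ((n : ℂ) - 1) * u) = (1 - u) ^ 2 := by
    field_simp
    ring
  rw [h]
  field_simp
  ring

/-- No pole has to be excluded: with `0⁻¹ = 0`, both sides vanish there. -/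
theorem groverZeta_top {n : ℕ} (hn : 4 ≤ n) (u : ℂ) :
    groverZeta (⊤ : SimpleGraph (Fin n)) u =
      (-1) ^ completeL n * (1 / (u - 1) ^ 2) * (1 / (u ^ 2 - 1) ^ completeL n)
        * (1 / (u ^ 2 + 2 / ((n : ℂ) - 1) * u + 1) ^ (n - 1)) := by
  rw [groverZeta, matrixZeta, det_one_sub_smul_groverMatrix_top hn, ← neg_sub (u ^ 2) 1,
    neg_pow (u ^ 2 - 1), ← neg_sub u 1, neg_sq, mul_inv, mul_inv, mul_inv, ← inv_pow (-1 : ℂ)]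
  simp only [one_div, inv_neg, inv_one]
  ring

end Complete

end SimpleGraph

/-! ### Euler's integral with complex parameter and sums over tuples -/

section GammaIntegral

open MeasureTheory Filter Set Topology

theorem integrableOn_rpow_mul_exp_neg_mul {s b : ℝ} (hs : -1 < s) (hb : 0 < b) :
    IntegrableOn (fun t : ℝ => t ^ s * Real.exp (-b * t)) (Ioi 0) := by
  simpa using integrableOn_rpow_mul_exp_neg_mul_rpow hs zero_lt_one hb

theorem norm_cpow_mul_exp_neg_mul (w r : ℂ) {t : ℝ} (ht : 0 < t) :
    ‖(t : ℂ) ^ (w - 1) * Complex.exp (-(r * t))‖ = t ^ (w.re - 1) * Real.exp (-r.re * t) := by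
  rw [norm_mul, Complex.norm_cpow_eq_rpow_re_of_pos ht, Complex.norm_exp]
  simp

theorem continuousOn_cpow_mul_exp_neg_mul (w r : ℂ) :
    ContinuousOn (fun t : ℝ => (t : ℂ) ^ (w - 1) * Complex.exp (-(r * t))) (Ioi 0) := by
  intro t ht
  refine ContinuousAt.continuousWithinAt (ContinuousAt.mul ?_ (by fun_prop))
  exact Complex.continuous_ofReal.continuousAt.cpow continuousAt_const
    (Complex.ofReal_mem_slitPlane.mpr ht)

theorem integrableOn_cpow_mul_exp_neg_mul {w r : ℂ} (hw : 0 < w.re) (hr : 0 < r.re) :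
    IntegrableOn (fun t : ℝ => (t : ℂ) ^ (w - 1) * Complex.exp (-(r * t))) (Ioi 0) := by
  refine Integrable.mono'
    (integrableOn_rpow_mul_exp_neg_mul (s := w.re - 1) (by linarith) hr) ?_ ?_
  · exact (continuousOn_cpow_mul_exp_neg_mul w r).aestronglyMeasurable measurableSet_Ioi
  · filter_upwards [ae_restrict_mem measurableSet_Ioi] with t ht
    exact (norm_cpow_mul_exp_neg_mul w r ht).le

theorem differentiableAt_integral_cpow_mul_exp_neg_mul {w r : ℂ} (hw : 0 < w.re) (hr : 0 < r.re) :
    DifferentiableAt ℂ (fun r : ℂ => ∫ t : ℝ in Ioi 0, (t : ℂ) ^ (w - 1) * Complex.exp (-(r * t)))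
      r := by
  have hs : {z : ℂ | r.re / 2 < z.re} ∈ 𝓝 r :=
    (isOpen_lt continuous_const Complex.continuous_re).mem_nhds (by
      change r.re / 2 < r.re
      linarith)
  refine (hasDerivAt_integral_of_dominated_loc_of_deriv_le (μ := volume.restrict (Ioi 0))
    (F := fun (z : ℂ) (t : ℝ) => (t : ℂ) ^ (w - 1) * Complex.exp (-(z * t)))
    (F' := fun (z : ℂ) (t : ℝ) => (t : ℂ) ^ (w - 1) * (Complex.exp (-(z * t)) * (-t)))
    -- Differentiating in `z` brings down a factor `t`, raising the exponent from `Re w - 1` to `Re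
    -- w`; `Re z > Re r / 2` gives uniform decay.
    (bound := fun t => t ^ w.re * Real.exp (-(r.re / 2) * t)) hs ?_
    (integrableOn_cpow_mul_exp_neg_mul hw hr) ?_ ?_
    (integrableOn_rpow_mul_exp_neg_mul (by linarith) (by linarith)) ?_).2.differentiableAt
  · exact Eventually.of_forall fun z =>
      (continuousOn_cpow_mul_exp_neg_mul w z).aestronglyMeasurable measurableSet_Ioi
  · simp_rw [← mul_assoc]
    exact ((continuousOn_cpow_mul_exp_neg_mul w r).mul
      (by fun_prop)).aestronglyMeasurable measurableSet_Ioi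
  · filter_upwards [ae_restrict_mem measurableSet_Ioi] with t ht z hz
    have ht' : 0 < t := ht
    have hz' : r.re / 2 < z.re := hz
    rw [← mul_assoc, norm_mul, norm_cpow_mul_exp_neg_mul w z ht, norm_neg, Complex.norm_real,
      Real.norm_of_nonneg ht'.le, mul_right_comm]
    nth_rewrite 2 [← Real.rpow_one t]
    rw [← Real.rpow_add ht', sub_add_cancel]
    gcongr
  · refine Eventually.of_forall fun t z _ => ?_
    have h : HasDerivAt (fun z : ℂ => -(z * t)) (-(t : ℂ)) z := by
      simpa using ((hasDerivAt_id' z).mul_const (t : ℂ)).fun_neg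
    exact h.cexp.const_mul _

/-- Euler's integral `∫ t^{w-1} e^{-rt} dt = Γ(w) r^{-w}` for complex `r` with positive real
part. -/
theorem integral_cpow_mul_exp_neg_mul {w r : ℂ} (hw : 0 < w.re) (hr : 0 < r.re) :
    ∫ t : ℝ in Ioi 0, (t : ℂ) ^ (w - 1) * Complex.exp (-(r * t)) =
      Complex.Gamma w * r ^ (-w) := by
  have hopen : IsOpen {z : ℂ | 0 < z.re} := isOpen_lt continuous_const Complex.continuous_re
  have hF : AnalyticOnNhd ℂ (fun r : ℂ => ∫ t : ℝ in Ioi 0,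
      (t : ℂ) ^ (w - 1) * Complex.exp (-(r * t))) {z : ℂ | 0 < z.re} :=
    DifferentiableOn.analyticOnNhd
      (fun z hz => (differentiableAt_integral_cpow_mul_exp_neg_mul hw hz).differentiableWithinAt) hopen
  have hH : AnalyticOnNhd ℂ (fun r : ℂ => Complex.Gamma w * r ^ (-w)) {z : ℂ | 0 < z.re} := by
    intro z hz
    have : z ∈ Complex.slitPlane := Or.inl hz
    exact analyticAt_const.mul (analyticAt_id.cpow analyticAt_const this)
  -- Identity theorem in `r`: the formula is known for positive real `r`, and these accumulate at
  -- `1`.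
  refine hF.eqOn_of_preconnected_of_frequently_eq hH (convex_halfSpace_re_gt 0).isPreconnected
    (z₀ := 1) (by simp) ?_ hr
  have hreal : ∀ x : ℝ, 0 < x → ∫ t : ℝ in Ioi 0, (t : ℂ) ^ (w - 1) * Complex.exp (-((x : ℂ) * t)) =
      Complex.Gamma w * (x : ℂ) ^ (-w) := by
    intro x hx
    rw [Complex.integral_cpow_mul_exp_neg_mul_Ioi hw hx, mul_comm, one_div, Complex.cpow_neg,
      Complex.inv_cpow]
    rw [Complex.arg_ofReal_of_nonneg hx.le]
    exact Real.pi_pos.ne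
  have ht : Tendsto (fun x : ℝ => (x : ℂ)) (𝓝[≠] 1) (𝓝[≠] 1) := by
    refine tendsto_nhdsWithin_iff.mpr ⟨?_, ?_⟩
    · have : Tendsto (fun x : ℝ => (x : ℂ)) (𝓝 1) (𝓝 ((1 : ℝ) : ℂ)) :=
        Complex.continuous_ofReal.continuousAt
      rw [Complex.ofReal_one] at this
      exact this.mono_left nhdsWithin_le_nhds
    · filter_upwards [self_mem_nhdsWithin] with x hx
      simpa using hx
  refine ht.frequently (Eventually.frequently ?_)
  filter_upwards [mem_nhdsWithin_of_mem_nhds (Ioi_mem_nhds zero_lt_one)] with x hx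
  exact hreal x hx

/-- Products of absolutely summable families indexed by tuples. -/
theorem summable_norm_and_tsum_fin_pi {R : Type*} [NormedField R] [CompleteSpace R] :
    ∀ {m : ℕ} {b : Fin m → ℕ → R}, (∀ j, Summable fun k => ‖b j k‖) →
      (Summable fun k : Fin m → ℕ => ‖∏ j, b j (k j)‖) ∧
        ∑' k : Fin m → ℕ, ∏ j, b j (k j) = ∏ j, ∑' i, b j i
  | 0, b, _ => ⟨(hasSum_unique _).summable, by simp⟩
  | m + 1, b, hb => by
    obtain ⟨h1, h2⟩ := summable_norm_and_tsum_fin_pi (b := fun j : Fin m => b j.succ)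
      fun j => hb j.succ
    let e : ℕ × (Fin m → ℕ) ≃ (Fin (m + 1) → ℕ) := Fin.consEquiv fun _ => ℕ
    have he : ∀ q : ℕ × (Fin m → ℕ),
        ∏ j, b j (e q j) = b 0 q.1 * ∏ j : Fin m, b j.succ (q.2 j) := by
      intro q
      rw [Fin.prod_univ_succ]
      rfl
    constructor
    · rw [← e.summable_iff]
      refine ((hb 0).mul_norm h1).congr fun q => ?_
      rw [Function.comp_apply, he]
    · rw [← e.tsum_eq, Fin.prod_univ_succ, ← h2, tsum_mul_tsum_of_summable_norm (hb 0) h1]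
      exact tsum_congr he

/-- Split the power into `m` equal factors and bound the `j`-th by `(k_j + 1)^{-σ/m}`. This leaves a
product of `m` one-variable series, convergent as `σ/m > 1`. -/
theorem summable_one_add_sum_rpow {m : ℕ} {σ : ℝ} (hσ : (m : ℝ) < σ) :
    Summable fun k : Fin m → ℕ => (1 + ∑ j, (k j : ℝ)) ^ (-σ) := by
  rcases Nat.eq_zero_or_pos m with rfl | hm
  · exact (hasSum_unique _).summable
  have hm' : (0 : ℝ) < m := Nat.cast_pos.mpr hm
  have hone : Summable fun i : ℕ => ‖((i : ℝ) + 1) ^ (-(σ / m))‖ := by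
    have := (summable_nat_add_iff 1).mpr
      (Real.summable_nat_rpow.mpr (neg_lt_neg ((one_lt_div hm').mpr hσ)))
    refine this.norm.congr fun i => ?_
    push_cast
    rfl
  refine Summable.of_nonneg_of_le (fun k => by positivity) (fun k => ?_)
    (summable_norm_and_tsum_fin_pi (m := m) (b := fun _ i => ((i : ℝ) + 1) ^ (-(σ / m)))
      fun _ => hone).1
  rw [Real.norm_of_nonneg (by positivity)]
  have hle : ∀ j, (k j : ℝ) + 1 ≤ 1 + ∑ j, (k j : ℝ) := fun j => by
    rw [add_comm]
    gcongr
    exact Finset.single_le_sum (f := fun j => (k j : ℝ)) (fun i _ => by positivity)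
      (Finset.mem_univ j)
  calc (1 + ∑ j, (k j : ℝ)) ^ (-σ) = ∏ _j : Fin m, (1 + ∑ j, (k j : ℝ)) ^ (-(σ / m)) := by
        rw [Finset.prod_const, Finset.card_univ, Fintype.card_fin, ← Real.rpow_mul_natCast
          (by positivity)]
        congr 1
        field_simp
    _ ≤ _ := Finset.prod_le_prod (fun j _ => by positivity) fun j _ =>
        Real.rpow_le_rpow_of_nonpos (by positivity) (hle j)
          (neg_nonpos.mpr (div_nonneg (hm'.le.trans hσ.le) hm'.le))

end GammaIntegral

/-! ### Continuation of normalized Mellin transforms to zero -/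

namespace Complex

open MeasureTheory Filter Asymptotics Set Topology

theorem hasMellin_finset_sum {ι : Type*} (S : Finset ι) {f : ι → ℝ → ℂ} {m : ι → ℂ} {w : ℂ}
    (h : ∀ i ∈ S, HasMellin (f i) w (m i)) :
    HasMellin (fun t => ∑ i ∈ S, f i t) w (∑ i ∈ S, m i) := by
  classical
  induction S using Finset.induction_on with
  | empty => simp [HasMellin, MellinConvergent, mellin]
  | insert i S hi ih =>
    have h1 := h i (Finset.mem_insert_self i S)
    have h2 := ih fun j hj => h j (Finset.mem_insert_of_mem hj)
    have := hasMellin_add h1.1 h2.1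
    rw [h1.2, h2.2] at this
    simpa only [Finset.sum_insert hi] using this

theorem hasMellin_singular_part (c : ℕ → ℂ) (N : ℕ) {w : ℂ} (hw : N < w.re) :
    HasMellin (fun t => ∑ j ∈ Finset.range (N + 1),
      c j • indicator (Ioc 0 1) (fun t : ℝ => (t : ℂ) ^ ((j : ℂ) - N)) t) w
      (∑ j ∈ Finset.range (N + 1), c j • (1 / (w + ((j : ℂ) - N)))) := by
  refine hasMellin_finset_sum _ fun j _ => ?_
  have h := hasMellin_cpow_Ioc ((j : ℂ) - N) (s := w) (by
    have : (0 : ℝ) ≤ j := j.cast_nonneg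
    simp
    linarith)
  have := hasMellin_const_smul h.1 (c j)
  rwa [h.2] at this

/-- Up to a combination of the powers `t ^ (j - N)` on `(0, 1]`, with `0 ≤ j ≤ N`, a function
meromorphic at `0` is of order `t` as `t → 0` from the right. -/
theorem exists_isBigO_sub_singular_part {g : ℂ → ℂ} (hg : MeromorphicAt g 0) :
    ∃ (N : ℕ) (c : ℕ → ℂ), (fun t : ℝ => g t - ∑ j ∈ Finset.range (N + 1),
      c j • indicator (Ioc 0 1) (fun t : ℝ => (t : ℂ) ^ ((j : ℂ) - N)) t)
        =O[𝓝[>] 0] fun t : ℝ => t ^ (-(-1 : ℝ)) := by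
  obtain ⟨N, p, hp⟩ := hg
  refine ⟨N, p.coeff, ?_⟩
  -- `z^N g` is analytic; its Taylor remainder of order `N + 1`, divided by `t^N`, is `O(t)`.
  have h1 := hp.isBigO_sub_partialSum_pow (N + 1)
  obtain ⟨C, hC⟩ := h1.bound
  have ht : Tendsto (fun t : ℝ => (t : ℂ)) (𝓝[>] 0) (𝓝 0) := by
    have : Tendsto (fun t : ℝ => (t : ℂ)) (𝓝 0) (𝓝 ((0 : ℝ) : ℂ)) :=
      continuous_ofReal.continuousAt
    rw [ofReal_zero] at this
    exact this.mono_left nhdsWithin_le_nhds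
  refine IsBigO.of_bound C ?_
  filter_upwards [ht.eventually hC, self_mem_nhdsWithin,
    mem_nhdsWithin_of_mem_nhds (Iio_mem_nhds zero_lt_one)] with t hb ht0 ht1
  have ht0' : 0 < t := ht0
  have ht1' : t < 1 := ht1
  have htc : (t : ℂ) ≠ 0 := ofReal_ne_zero.mpr ht0'.ne'
  have hmem : t ∈ Ioc (0 : ℝ) 1 := ⟨ht0', ht1'.le⟩
  have hsum : p.partialSum (N + 1) (t : ℂ) = (t : ℂ) ^ N * ∑ j ∈ Finset.range (N + 1),
      p.coeff j • indicator (Ioc 0 1) (fun t : ℝ => (t : ℂ) ^ ((j : ℂ) - N)) t := by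
    rw [FormalMultilinearSeries.partialSum, Finset.mul_sum]
    refine Finset.sum_congr rfl fun j _ => ?_
    rw [FormalMultilinearSeries.apply_eq_pow_smul_coeff, indicator_of_mem hmem,
      cpow_sub _ _ htc, cpow_natCast, cpow_natCast, smul_eq_mul, smul_eq_mul]
    field_simp
  rw [zero_add, sub_zero, hsum, smul_eq_mul, ← mul_sub, norm_mul, norm_pow, norm_pow, norm_norm,
    norm_real, Real.norm_of_nonneg ht0'.le, pow_succ] at hb
  rw [neg_neg, Real.rpow_one, Real.norm_of_nonneg ht0'.le]
  have hpos : 0 < t ^ N := pow_pos ht0' N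
  refine le_of_mul_le_mul_left ?_ hpos
  linarith

theorem locallyIntegrableOn_singular_part (c : ℕ → ℂ) (N : ℕ) :
    LocallyIntegrableOn (fun t => ∑ j ∈ Finset.range (N + 1),
      c j • indicator (Ioc 0 1) (fun t : ℝ => (t : ℂ) ^ ((j : ℂ) - N)) t) (Ioi 0) := by
  have hterm : ∀ j, ContinuousOn (fun t : ℝ => c j • (t : ℂ) ^ ((j : ℂ) - N)) (Ioi 0) := by
    intro j t ht
    have : (t : ℂ) ∈ slitPlane := ofReal_mem_slitPlane.mpr ht
    have h : ContinuousAt (fun t : ℝ => (t : ℂ) ^ ((j : ℂ) - N)) t :=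
      continuous_ofReal.continuousAt.cpow continuousAt_const this
    exact (h.const_smul (c j)).continuousWithinAt
  have hsum : LocallyIntegrableOn (fun t : ℝ => ∑ j ∈ Finset.range (N + 1),
      c j • (t : ℂ) ^ ((j : ℂ) - N)) (Ioi 0) :=
    (continuousOn_finsetSum _ fun j _ => hterm j).locallyIntegrableOn measurableSet_Ioi
  intro t ht
  obtain ⟨u, hu, hi⟩ := hsum t ht
  refine ⟨u, hu, ?_⟩
  have := hi.indicator (measurableSet_Ioc (a := (0 : ℝ)) (b := 1))
  refine this.congr (Eventually.of_forall fun x => ?_)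
  by_cases hx : x ∈ Ioc (0 : ℝ) 1 <;> simp [hx]

/-- The normalized Mellin transform `Γ(w)⁻¹ ∫ g(t) t^{w-1} dt` continues to `w = 0`. -/
theorem exists_continuesToZero_mellin {g : ℂ → ℂ} (hg : MeromorphicAt g 0)
    (hc : ContinuousOn (fun t : ℝ => g t) (Ioi 0)) {a : ℝ} (ha : 0 < a)
    (htop : (fun t : ℝ => g t) =O[atTop] fun t => Real.exp (-a * t)) :
    ∃ Φ, ContinuesToZero (fun w => 1 / Gamma w * mellin (fun t : ℝ => g t) w) Φ := by
  obtain ⟨N, c, hbot⟩ := exists_isBigO_sub_singular_part hg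
  set R : ℝ → ℂ := fun t => ∑ j ∈ Finset.range (N + 1),
      c j • indicator (Ioc 0 1) (fun t : ℝ => (t : ℂ) ^ ((j : ℂ) - N)) t with hR
  set G : ℝ → ℂ := fun t => g t - R t with hG
  have hloc : LocallyIntegrableOn G (Ioi 0) :=
    (hc.locallyIntegrableOn measurableSet_Ioi).sub (locallyIntegrableOn_singular_part c N)
  have htop' : G =O[atTop] fun t => Real.exp (-a * t) := by
    refine htop.congr' ?_ EventuallyEq.rfl
    filter_upwards [eventually_gt_atTop 1] with t ht
    have : t ∉ Ioc (0 : ℝ) 1 := fun h => absurd h.2 (not_le.mpr ht)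
    simp [hG, hR, this]
  -- The bound `O(t)` at the origin moves the abscissa of holomorphy to `-1`, past `w = 0`.
  have hdiff : ∀ w : ℂ, -1 < w.re → DifferentiableAt ℂ (mellin G) w := fun w hw =>
    mellin_differentiableAt_of_isBigO_rpow_exp ha hloc htop' hbot hw
  have hmellin : ∀ w : ℂ, (N : ℝ) < w.re → mellin (fun t : ℝ => g t) w =
      mellin G w + ∑ j ∈ Finset.range (N + 1), c j • (1 / (w + ((j : ℂ) - N))) := by
    intro w hw
    have h1 : MellinConvergent G w := mellinConvergent_of_isBigO_rpow_exp ha hloc htop' hbot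
      (by have : (0 : ℝ) ≤ N := N.cast_nonneg
          linarith)
    have h2 := hasMellin_singular_part c N hw
    have := (hasMellin_add h1 h2.1).2
    rw [h2.2] at this
    rw [← this]
    congr 1
    ext t
    simp [hG, hR]
  have hopen : IsOpen {w : ℂ | -1 < w.re} := isOpen_lt continuous_const continuous_re
  have han : ∀ w : ℂ, -1 < w.re → AnalyticAt ℂ (mellin G) w := fun w hw =>
    DifferentiableOn.analyticAt (s := {w : ℂ | -1 < w.re})
      (fun z hz => (hdiff z hz).differentiableWithinAt) (hopen.mem_nhds hw)
  have hGamma : ∀ w : ℂ, AnalyticAt ℂ (fun w => (Gamma w)⁻¹) w := fun w =>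
    differentiable_one_div_Gamma.analyticAt w
  have hGamma1 : ∀ w : ℂ, AnalyticAt ℂ (fun w => (Gamma (w + 1))⁻¹) w := fun w =>
    (differentiable_one_div_Gamma.comp (differentiable_id.add_const 1)).analyticAt w
  -- Only the term `j = N` is singular at `w = 0`; it is rewritten by `1/(w Γ(w)) = 1/Γ(w+1)`. The
  -- terms `j < N` have their poles at positive integers.
  refine ⟨fun w => (Gamma w)⁻¹ * (mellin G w + ∑ j ∈ Finset.range N,
    c j • (1 / (w + ((j : ℂ) - N)))) + c N * (Gamma (w + 1))⁻¹, ⟨N, fun w hw => ?_⟩,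
    ⟨1, one_pos, fun w hw => ?_⟩, ?_⟩
  · have hw0 : w ≠ 0 := by
      rintro rfl
      have : (0 : ℝ) ≤ N := N.cast_nonneg
      rw [zero_re] at hw
      linarith
    rw [hmellin w hw, Finset.sum_range_succ, Gamma_add_one w hw0]
    simp
    ring
  · have h1 : MeromorphicAt (mellin G) w := (han w hw).meromorphicAt
    have h2 : MeromorphicAt (fun w => (Gamma w)⁻¹) w := (hGamma w).meromorphicAt
    have h3 : MeromorphicAt (fun w => (Gamma (w + 1))⁻¹) w := (hGamma1 w).meromorphicAt
    have h4 : MeromorphicAt (fun w : ℂ => ∑ j ∈ Finset.range N,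
        c j • (1 / (w + ((j : ℂ) - N)))) w := by
      fun_prop
    fun_prop
  · have h1 : AnalyticAt ℂ (mellin G) 0 := han 0 (by simp)
    have h2 := hGamma 0
    have h3 := hGamma1 0
    have h4 : AnalyticAt ℂ (fun w : ℂ => ∑ j ∈ Finset.range N,
        c j • (1 / (w + ((j : ℂ) - N)))) 0 := by
      refine Finset.analyticAt_fun_sum _ fun j hj => ?_
      have h : AnalyticAt ℂ (fun w : ℂ => w + ((j : ℂ) - N)) 0 := by fun_prop
      simp only [smul_eq_mul]
      refine analyticAt_const.mul (analyticAt_const.div h ?_)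
      rw [zero_add, sub_ne_zero]
      exact_mod_cast (Finset.mem_range.mp hj).ne
    fun_prop

end Complex

section CompleteGraphSeries

open MeasureTheory Filter Set Topology

/-! ### The coefficients `P_l`: recurrence, bound, generating function -/

section Coefficients

theorem completeP_eq_sum_antidiagonal (n l : ℕ) :
    completeP n l = ∑ p ∈ Finset.HasAntidiagonal.antidiagonal l,
      (-1) ^ p.1 * (p.1.choose p.2 : ℝ) * (2 / ((n : ℝ) - 1)) ^ (p.1 - p.2) := by
  rw [← Finset.Nat.sum_antidiagonal_swap, Finset.Nat.sum_antidiagonal_eq_sum_range_succ_mk,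
    completeP]
  refine Finset.sum_subset_zero_on_sdiff ?_ ?_ ?_
  · refine Finset.range_subset_range.mpr ?_
    have := Nat.div_le_self l 2
    omega
  · intro i hi
    simp only [Finset.mem_sdiff, Finset.mem_range] at hi
    simp [Nat.choose_eq_zero_of_lt (by omega : l - i < i)]
  · intro i _
    simp only [Prod.swap_prod_mk]
    congr 2
    omega

theorem completeP_zero (n : ℕ) : completeP n 0 = 1 := by simp [completeP]

theorem completeP_one (n : ℕ) : completeP n 1 = -(2 / ((n : ℝ) - 1)) := by simp [completeP]

/-- Pascal's rule, applied termwise to the sum over the antidiagonal. -/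
theorem completeP_add_two (n l : ℕ) :
    completeP n (l + 2) = -(2 / ((n : ℝ) - 1)) * completeP n (l + 1) - completeP n l := by
  simp only [completeP_eq_sum_antidiagonal]
  rw [Finset.Nat.sum_antidiagonal_succ, Finset.Nat.sum_antidiagonal_succ' (n := l),
    Finset.Nat.sum_antidiagonal_succ' (n := l),
    mul_add, Finset.mul_sum]
  simp only [Nat.choose_zero_succ, Nat.cast_zero, mul_zero, zero_mul, Nat.choose_zero_right,
    Nat.cast_one, mul_one, Nat.sub_zero]
  have : ∀ p : ℕ × ℕ, (-1 : ℝ) ^ (p.1 + 1) * ((p.1 + 1).choose (p.2 + 1) : ℝ) *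
      (2 / ((n : ℝ) - 1)) ^ (p.1 + 1 - (p.2 + 1)) =
      -(2 / ((n : ℝ) - 1)) * ((-1) ^ p.1 * (p.1.choose (p.2 + 1) : ℝ) *
        (2 / ((n : ℝ) - 1)) ^ (p.1 - (p.2 + 1))) -
      (-1) ^ p.1 * (p.1.choose p.2 : ℝ) * (2 / ((n : ℝ) - 1)) ^ (p.1 - p.2) := by
    intro p
    rw [Nat.add_sub_add_right, Nat.choose_succ_succ, Nat.cast_add]
    rcases lt_or_ge p.2 p.1 with h | h
    · have : p.1 - p.2 = p.1 - (p.2 + 1) + 1 := by omega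
      rw [this]
      ring
    · rw [Nat.choose_eq_zero_of_lt (Nat.lt_succ_of_le h)]
      simp
      ring
  rw [Finset.sum_congr rfl fun p _ => this p, Finset.sum_sub_distrib]
  ring

/-- By the recurrence, `P_{l+2}` and `P_l` are the two roots of one quadratic with parameter
`P_{l+1}`, so the form is conserved. It serves to bound `P_l`. -/
theorem completeP_invariant (n l : ℕ) :
    completeP n (l + 1) ^ 2 + 2 / ((n : ℝ) - 1) * completeP n (l + 1) * completeP n l
      + completeP n l ^ 2 = 1 := by
  induction l with
  | zero =>
    rw [zero_add, completeP_one, completeP_zero]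
    ring
  | succ l ih =>
    rw [completeP_add_two]
    linear_combination ih

/-- With `a = 2/(n-1) ≤ 1` the invariant form is positive definite: completing the square gives `(1
- a²/4) P_l² ≤ 1`. -/
theorem abs_completeP_le {n : ℕ} (hn : 4 ≤ n) (l : ℕ) : |completeP n l| ≤ 2 := by
  have hn' : (4 : ℝ) ≤ n := by exact_mod_cast hn
  have h0 : 0 ≤ 2 / ((n : ℝ) - 1) := div_nonneg zero_le_two (by linarith)
  have h1 : 2 / ((n : ℝ) - 1) ≤ 1 := (div_le_one (by linarith)).mpr (by linarith)
  have h2 : (2 / ((n : ℝ) - 1)) ^ 2 ≤ 1 := pow_le_one₀ h0 h1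
  have h := completeP_invariant n l
  refine abs_le_of_sq_le_sq ?_ zero_le_two
  nlinarith [sq_nonneg (completeP n (l + 1) + 2 / ((n : ℝ) - 1) / 2 * completeP n l),
    sq_nonneg (completeP n l)]

theorem summable_norm_completeP_mul_pow {n : ℕ} (hn : 4 ≤ n) {y : ℂ} (hy : ‖y‖ < 1) :
    Summable fun k => ‖(completeP n k : ℂ) * y ^ k‖ := by
  refine Summable.of_nonneg_of_le (fun k => norm_nonneg _) (fun k => ?_)
    ((summable_geometric_of_lt_one (norm_nonneg y) hy).mul_left 2)
  rw [norm_mul, norm_pow, Complex.norm_real, Real.norm_eq_abs]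
  gcongr
  exact abs_completeP_le hn k

theorem tsum_completeP_mul_pow {n : ℕ} (hn : 4 ≤ n) {y : ℂ} (hy : ‖y‖ < 1) :
    ∑' k, (completeP n k : ℂ) * y ^ k = (1 + 2 / ((n : ℂ) - 1) * y + y ^ 2)⁻¹ := by
  have hs : Summable fun k => (completeP n k : ℂ) * y ^ k :=
    (summable_norm_completeP_mul_pow hn hy).of_norm
  have h1 := hs.tsum_eq_zero_add
  have hs1 := (summable_nat_add_iff 1).mpr hs
  have h2 := hs1.tsum_eq_zero_add
  have h3 : ∑' k, (completeP n (k + 1 + 1) : ℂ) * y ^ (k + 1 + 1) =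
      -(2 / ((n : ℂ) - 1)) * y * ∑' k, (completeP n (k + 1) : ℂ) * y ^ (k + 1)
        - y ^ 2 * ∑' k, (completeP n k : ℂ) * y ^ k := by
    rw [← tsum_mul_left, ← tsum_mul_left, ← (hs1.mul_left _).tsum_sub (hs.mul_left _)]
    refine tsum_congr fun k => ?_
    rw [completeP_add_two]
    push_cast
    ring
  rw [h3] at h2
  rw [zero_add, completeP_one, pow_one] at h2
  rw [completeP_zero] at h1
  push_cast at h1 h2
  refine eq_inv_of_mul_eq_one_left ?_
  linear_combination h1 * (1 + 2 / ((n : ℂ) - 1) * y) + h2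

end Coefficients

/-! ### Expansion of the zeta function in powers of `y = u⁻¹` -/

section Expansion

/-- The `j`-th factor of the expansion of the zeta function of the complete graph in powers of
`y = u⁻¹`. -/
noncomputable def completeFactor (n : ℕ) (y : ℂ) (j k : ℕ) : ℂ :=
  if j < 2 then y ^ (k + 1) else if j < completeL n + 2 then y ^ (2 * k + 2)
  else (completeP n k : ℂ) * y ^ (k + 2)

theorem two_mul_completeL {n : ℕ} (hn : 4 ≤ n) : 2 * completeL n + 2 * n = n * (n - 1) := by
  rw [completeL, Nat.mul_div_cancel']
  · obtain ⟨m, rfl⟩ := Nat.exists_eq_add_of_le hn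
    rw [show 4 + m - 3 = m + 1 by omega, show 4 + m - 1 = m + 3 by omega]
    ring
  · obtain ⟨m, rfl⟩ := Nat.exists_eq_add_of_le hn
    rw [show 4 + m - 3 = m + 1 by omega, show (4 + m) * (m + 1) = m * (m + 1) + 4 * (m + 1) by ring]
    exact dvd_add (Nat.even_mul_succ_self m).two_dvd (by omega)

theorem completeM_eq {n : ℕ} (hn : 4 ≤ n) : completeM n = 2 + completeL n + (n - 1) := by
  have h := two_mul_completeL hn
  rw [completeM, sq, ← Nat.mul_sub_one, ← h]
  omega

theorem prod_completeFactor (n : ℕ) (y : ℂ) (k : Fin (completeM n) → ℕ) :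
    ∏ j : Fin (completeM n), completeFactor n y j (k j) =
      (completeCoeff n k : ℂ) * y ^ completeExponent n k := by
  rw [completeCoeff, completeExponent, pow_add, pow_add, ← Finset.prod_pow_eq_pow_sum,
    ← Finset.prod_pow_eq_pow_sum, ← Finset.prod_pow_eq_pow_sum, Complex.ofReal_prod]
  simp only [Finset.prod_filter]
  rw [← Finset.prod_mul_distrib, ← Finset.prod_mul_distrib, ← Finset.prod_mul_distrib]
  refine Finset.prod_congr rfl fun j _ => ?_
  rw [completeFactor]
  rcases lt_or_ge j.val 2 with h1 | h1
  · have h3 : ¬ completeL n + 2 ≤ j.val := by omega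
    simp [h1, h1.not_ge, h3]
  · rcases lt_or_ge j.val (completeL n + 2) with h2 | h2
    · simp [h1, h1.not_gt, h2, h2.not_ge]
    · simp [h1.not_gt, h2, h2.not_gt]

/-- Over a general commutative monoid, so that it also evaluates sums, through `Multiplicative ℕ`.
-/
theorem prod_ite_fin_completeM {R : Type*} [CommMonoid R] {n : ℕ} (hn : 4 ≤ n) (a b c : R) :
    (∏ j : Fin (completeM n), if j.val < 2 then a else if j.val < completeL n + 2 then b else c) =
      a ^ 2 * b ^ completeL n * c ^ (n - 1) := by
  rw [Fin.prod_univ_eq_prod_range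
    (fun j => if j < 2 then a else if j < completeL n + 2 then b else c), completeM_eq hn,
    Finset.prod_range_add, Finset.prod_range_add]
  congr 1
  · congr 1
    · rw [Finset.prod_congr rfl fun j hj => if_pos (Finset.mem_range.mp hj)]
      simp
    · rw [Finset.prod_congr rfl fun j hj => by
        have := Finset.mem_range.mp hj
        rw [if_neg (by omega), if_pos (by omega)]]
      simp
  · rw [Finset.prod_congr rfl fun j hj => by rw [if_neg (by omega), if_neg (by omega)]]
    simp

/-- The constant is the exponent at `k = 0`, namely `2 + 2L + 2(n-1)`. This is where the condition
`Re s > -n(n-1)` comes from. -/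
theorem le_completeExponent {n : ℕ} (hn : 4 ≤ n) (k : Fin (completeM n) → ℕ) :
    n * (n - 1) + ∑ j, k j ≤ completeExponent n k := by
  have h : (∑ j : Fin (completeM n),
      if j.val < 2 then 1 else if j.val < completeL n + 2 then 2 else 2) = n * (n - 1) := by
    have := prod_ite_fin_completeM hn (Multiplicative.ofAdd 1) (Multiplicative.ofAdd 2)
      (Multiplicative.ofAdd 2)
    have h' := congrArg Multiplicative.toAdd this
    simp only [toAdd_prod, toAdd_mul, toAdd_pow, smul_eq_mul, apply_ite Multiplicative.toAdd,
      toAdd_ofAdd] at h'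
    rw [h', ← two_mul_completeL hn]
    omega
  rw [← h, completeExponent, ← Finset.sum_add_distrib]
  simp only [Finset.sum_filter]
  rw [← Finset.sum_add_distrib, ← Finset.sum_add_distrib]
  refine Finset.sum_le_sum fun j _ => ?_
  split_ifs <;> omega

theorem summable_norm_completeFactor {n : ℕ} (hn : 4 ≤ n) {y : ℂ} (hy : ‖y‖ < 1) (j : ℕ) :
    Summable fun k => ‖completeFactor n y j k‖ := by
  have hy2 : ‖y ^ 2‖ < 1 := by
    rw [norm_pow]
    exact pow_lt_one₀ (norm_nonneg y) hy two_ne_zero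
  unfold completeFactor
  split_ifs
  · refine ((summable_norm_geometric_of_norm_lt_one hy).mul_right ‖y‖).congr fun k => ?_
    rw [← norm_mul, pow_succ]
  · refine ((summable_norm_geometric_of_norm_lt_one hy2).mul_right ‖y ^ 2‖).congr fun k => ?_
    rw [← norm_mul, ← pow_mul, ← pow_add]
  · refine ((summable_norm_completeP_mul_pow hn hy).mul_right ‖y ^ 2‖).congr fun k => ?_
    rw [← norm_mul, mul_assoc, ← pow_add]

theorem tsum_completeFactor {n : ℕ} (hn : 4 ≤ n) {y : ℂ} (hy : ‖y‖ < 1) (j : ℕ) :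
    ∑' k, completeFactor n y j k = if j < 2 then y * (1 - y)⁻¹
      else if j < completeL n + 2 then y ^ 2 * (1 - y ^ 2)⁻¹
      else y ^ 2 * (1 + 2 / ((n : ℂ) - 1) * y + y ^ 2)⁻¹ := by
  have hy2 : ‖y ^ 2‖ < 1 := by
    rw [norm_pow]
    exact pow_lt_one₀ (norm_nonneg y) hy two_ne_zero
  unfold completeFactor
  split_ifs
  · rw [← tsum_geometric_of_norm_lt_one hy, ← tsum_mul_left]
    simp_rw [pow_succ']
  · rw [← tsum_geometric_of_norm_lt_one hy2, ← tsum_mul_left]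
    refine tsum_congr fun k => ?_
    rw [← pow_mul, ← pow_add, add_comm]
  · rw [← tsum_completeP_mul_pow hn hy, ← tsum_mul_left]
    refine tsum_congr fun k => ?_
    rw [pow_add]
    ring

theorem groverZeta_top_inv {n : ℕ} (hn : 4 ≤ n) {y : ℂ} (hy : y ≠ 0) :
    groverZeta (⊤ : SimpleGraph (Fin n)) y⁻¹ = (-1) ^ completeL n *
      ((y * (1 - y)⁻¹) ^ 2 * (y ^ 2 * (1 - y ^ 2)⁻¹) ^ completeL n *
        (y ^ 2 * (1 + 2 / ((n : ℂ) - 1) * y + y ^ 2)⁻¹) ^ (n - 1)) := by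
  have h1 : y⁻¹ - 1 = (y * (1 - y)⁻¹)⁻¹ := by
    rw [mul_inv, inv_inv, mul_sub, inv_mul_cancel₀ hy, mul_one]
  have h2 : y⁻¹ ^ 2 - 1 = (y ^ 2 * (1 - y ^ 2)⁻¹)⁻¹ := by
    rw [mul_inv, inv_inv, mul_sub, inv_mul_cancel₀ (pow_ne_zero 2 hy), mul_one, inv_pow]
  have h3 : y⁻¹ ^ 2 + 2 / ((n : ℂ) - 1) * y⁻¹ + 1 =
      (y ^ 2 * (1 + 2 / ((n : ℂ) - 1) * y + y ^ 2)⁻¹)⁻¹ := by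
    rw [mul_inv, inv_inv, mul_add, mul_add, inv_mul_cancel₀ (pow_ne_zero 2 hy), mul_one, inv_pow,
      mul_left_comm, sq, mul_inv, mul_assoc, inv_mul_cancel₀ hy, mul_one]
  rw [SimpleGraph.groverZeta_top hn, h1, h2, h3]
  simp only [inv_pow, one_div, inv_inv]
  ring

theorem hasSum_groverZeta_top_inv {n : ℕ} (hn : 4 ≤ n) {y : ℂ} (hy0 : y ≠ 0) (hy : ‖y‖ < 1) :
    (Summable fun k : Fin (completeM n) → ℕ =>
      ‖(completeCoeff n k : ℂ) * y ^ completeExponent n k‖) ∧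
    groverZeta (⊤ : SimpleGraph (Fin n)) y⁻¹ = (-1) ^ completeL n *
      ∑' k : Fin (completeM n) → ℕ, (completeCoeff n k : ℂ) * y ^ completeExponent n k := by
  obtain ⟨h1, h2⟩ := summable_norm_and_tsum_fin_pi
    (b := fun (j : Fin (completeM n)) k => completeFactor n y j k)
    fun j => summable_norm_completeFactor hn hy j
  simp only [prod_completeFactor] at h1 h2
  refine ⟨h1, ?_⟩
  rw [h2, groverZeta_top_inv hn hy0, ← prod_ite_fin_completeM hn]
  congr 1
  exact Finset.prod_congr rfl fun j _ => (tsum_completeFactor hn hy j).symm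

theorem abs_completeCoeff_le {n : ℕ} (hn : 4 ≤ n) (k : Fin (completeM n) → ℕ) :
    |completeCoeff n k| ≤ 2 ^ completeM n := by
  rw [completeCoeff, Finset.abs_prod]
  calc _ ≤ ∏ N : Fin (completeM n) with completeL n + 2 ≤ N.val, (2 : ℝ) :=
        Finset.prod_le_prod (fun _ _ => abs_nonneg _) fun N _ => abs_completeP_le hn _
    _ ≤ _ := by
        rw [Finset.prod_const]
        refine pow_le_pow_right₀ one_le_two ?_
        exact (Finset.card_le_univ _).trans (by simp)

end Expansion

end CompleteGraphSeries

/-! ### Termwise integration and continuation for the complete graph -/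

section CompleteGraphZeta

open MeasureTheory Filter Set Topology

/-- The integral of the absolute Hurwitz zeta function in the variable `t = log x`. -/
theorem exp_smul_absoluteHurwitzIntegrand (f : ℝ → ℂ) (w s : ℂ) (t : ℝ) :
    Real.exp t • absoluteHurwitzIntegrand f w s (Real.exp t) =
      (t : ℂ) ^ (w - 1) • (f (Real.exp t) * Complex.exp (-s * t)) := by
  have h : (Real.exp t : ℂ) ^ (-s - 1) = Complex.exp (-s * t) * (Real.exp t : ℂ)⁻¹ := by
    have h0 : (Real.exp t : ℂ) ≠ 0 := Complex.ofReal_ne_zero.mpr (Real.exp_pos t).ne'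
    rw [Complex.cpow_sub _ _ h0, Complex.cpow_one, Complex.cpow_def_of_ne_zero h0,
      ← Complex.ofReal_log (Real.exp_pos t).le, Real.log_exp, mul_comm (t : ℂ), div_eq_mul_inv]
  have h0 : (Real.exp t : ℂ) ≠ 0 := Complex.ofReal_ne_zero.mpr (Real.exp_pos t).ne'
  rw [absoluteHurwitzIntegrand, h, Real.log_exp, Complex.real_smul, smul_eq_mul]
  field_simp

theorem absoluteHurwitzZeta_eq_mellin (f : ℝ → ℂ) (w s : ℂ) :
    absoluteHurwitzZeta f w s = 1 / Complex.Gamma w *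
      mellin (fun t => f (Real.exp t) * Complex.exp (-s * t)) w := by
  rw [absoluteHurwitzZeta, mellin, ← Real.exp_zero, ← integral_comp_exp_Ioi]
  simp only [exp_smul_absoluteHurwitzIntegrand]

theorem integrableOn_absoluteHurwitzIntegrand_iff (f : ℝ → ℂ) (w s : ℂ) :
    IntegrableOn (absoluteHurwitzIntegrand f w s) (Ioi 1) ↔
      MellinConvergent (fun t => f (Real.exp t) * Complex.exp (-s * t)) w := by
  rw [MellinConvergent, ← Real.exp_zero, ← integrableOn_comp_exp_Ioi]
  simp only [exp_smul_absoluteHurwitzIntegrand]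

/-- Tonelli: the norm of the sum is at most the sum of the norms, whose integral is finite. -/
theorem integrable_tsum_of_summable_integral_norm {α ι E : Type*} [MeasurableSpace α]
    {μ : Measure α} [Countable ι] [NormedAddCommGroup E] {F : ι → α → E} {G : α → E}
    (hG : AEStronglyMeasurable G μ) (hF : ∀ i, Integrable (F i) μ)
    (hsum : Summable fun i => ∫ a, ‖F i a‖ ∂μ) (hFG : ∀ᵐ a ∂μ, HasSum (F · a) (G a)) :
    Integrable G μ := by
  refine ⟨hG, ?_⟩
  have hle : ∫⁻ a, ‖G a‖ₑ ∂μ ≤ ∫⁻ a, ∑' i, ‖F i a‖ₑ ∂μ := by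
    refine lintegral_mono_ae ?_
    filter_upwards [hFG] with a ha
    refine le_of_tendsto (ha.enorm) (Eventually.of_forall fun S => ?_)
    exact (enorm_sum_le _ _).trans (ENNReal.sum_le_tsum S)
  refine lt_of_le_of_lt hle ?_
  rw [lintegral_tsum fun i => (hF i).1.enorm]
  have : ∀ i, ∫⁻ a, ‖F i a‖ₑ ∂μ = ENNReal.ofReal (∫ a, ‖F i a‖ ∂μ) := fun i => by
    rw [ofReal_integral_norm_eq_lintegral_enorm (hF i)]
  simp_rw [this]
  exact hsum.tsum_ofReal_lt_top

section Complete

theorem re_completeExponent_add_ge {n : ℕ} (hn : 4 ≤ n) {s : ℂ}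
    (hs : -((n : ℝ) * ((n : ℝ) - 1)) < s.re) :
    ∃ ε : ℝ, 0 < ε ∧ ∀ k : Fin (completeM n) → ℕ,
      ε * (1 + ∑ j, (k j : ℝ)) ≤ ((completeExponent n k : ℂ) + s).re := by
  have h0 : 0 < (n : ℝ) * ((n : ℝ) - 1) + s.re := by linarith
  refine ⟨min 1 ((n : ℝ) * ((n : ℝ) - 1) + s.re), lt_min one_pos h0, fun k => ?_⟩
  have h1 : (n : ℝ) * ((n : ℝ) - 1) + ∑ j, (k j : ℝ) ≤ completeExponent n k := by
    have := le_completeExponent hn k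
    have h2 : ((n * (n - 1) + ∑ j, k j : ℕ) : ℝ) ≤ completeExponent n k := by exact_mod_cast this
    rw [Nat.cast_add, Nat.cast_mul, Nat.cast_sub (by omega), Nat.cast_one, Nat.cast_sum] at h2
    exact h2
  have h3 : 0 ≤ ∑ j, (k j : ℝ) := Finset.sum_nonneg fun j _ => Nat.cast_nonneg _
  rw [mul_add, mul_one, Complex.add_re, Complex.natCast_re]
  have h4 : min 1 ((n : ℝ) * ((n : ℝ) - 1) + s.re) * ∑ j, (k j : ℝ) ≤ 1 * ∑ j, (k j : ℝ) :=
    mul_le_mul_of_nonneg_right (min_le_left _ _) h3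
  have h5 := min_le_right 1 ((n : ℝ) * ((n : ℝ) - 1) + s.re)
  linarith

/-- The terms of the expansion of the Mellin integrand. -/
noncomputable def completeTerm (n : ℕ) (w s : ℂ) (k : Fin (completeM n) → ℕ) (t : ℝ) : ℂ :=
  (completeCoeff n k : ℂ) *
    ((t : ℂ) ^ (w - 1) * Complex.exp (-(((completeExponent n k : ℂ) + s) * t)))

theorem hasSum_completeTerm {n : ℕ} (hn : 4 ≤ n) (w s : ℂ) {t : ℝ} (ht : 0 < t) :
    HasSum (fun k => (-1) ^ completeL n * completeTerm n w s k t)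
      ((t : ℂ) ^ (w - 1) • (groverZeta (⊤ : SimpleGraph (Fin n)) (Real.exp t : ℂ)
        * Complex.exp (-s * t))) := by
  have hy0 : Complex.exp (-t) ≠ 0 := Complex.exp_ne_zero _
  have hy : ‖Complex.exp (-t)‖ < 1 := by
    rw [Complex.norm_exp]
    simpa using ht
  obtain ⟨h1, h2⟩ := hasSum_groverZeta_top_inv hn hy0 hy
  have h3 := ((h1.of_norm.hasSum.mul_left ((-1 : ℂ) ^ completeL n)).mul_right
    (Complex.exp (-s * t))).mul_left ((t : ℂ) ^ (w - 1))
  rw [← h2, Complex.exp_neg, inv_inv, ← Complex.ofReal_exp] at h3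
  rw [smul_eq_mul]
  refine h3.congr_fun ?_
  intro k
  have : Complex.exp (-(((completeExponent n k : ℂ) + s) * t)) =
      Complex.exp (-t) ^ completeExponent n k * Complex.exp (-s * t) := by
    rw [← Complex.exp_nat_mul, ← Complex.exp_add]
    congr 1
    ring
  rw [completeTerm, this, Complex.exp_neg, Complex.ofReal_exp]
  ring

variable {n : ℕ} {s w : ℂ}

theorem integral_completeTerm (hn : 4 ≤ n) (hs : -((n : ℝ) * ((n : ℝ) - 1)) < s.re)
    (hw : 0 < w.re) (k : Fin (completeM n) → ℕ) :
    IntegrableOn (completeTerm n w s k) (Ioi 0) ∧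
    ∫ t in Ioi 0, completeTerm n w s k t =
      Complex.Gamma w * ((completeCoeff n k : ℂ) / ((completeExponent n k : ℂ) + s) ^ w) := by
  obtain ⟨ε, hε, h⟩ := re_completeExponent_add_ge hn hs
  have hr : 0 < ((completeExponent n k : ℂ) + s).re := lt_of_lt_of_le (by positivity) (h k)
  refine ⟨(integrableOn_cpow_mul_exp_neg_mul hw hr).const_mul _, ?_⟩
  simp only [completeTerm]
  rw [integral_const_mul, integral_cpow_mul_exp_neg_mul hw hr, Complex.cpow_neg]
  ring

/-- The norms integrate to `|a(k)| Γ(Re w) Re(c(k)+s)^{-Re w}`. With `a(k)` bounded and linear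
growth of the base, this is dominated by the series of `(1 + ∑ k_j)^{-Re w}` over `M`-tuples. -/
theorem summable_integral_norm_completeTerm (hn : 4 ≤ n)
    (hs : -((n : ℝ) * ((n : ℝ) - 1)) < s.re) (hw : (completeM n : ℝ) < w.re) :
    Summable fun k => ∫ t in Ioi 0, ‖completeTerm n w s k t‖ := by
  obtain ⟨ε, hε, h⟩ := re_completeExponent_add_ge hn hs
  have hw0 : 0 < w.re := lt_of_le_of_lt (Nat.cast_nonneg _) hw
  have hΓ : 0 < Real.Gamma w.re := Real.Gamma_pos_of_pos hw0
  refine Summable.of_nonneg_of_le (fun k => integral_nonneg fun t => norm_nonneg _) (fun k => ?_)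
    ((summable_one_add_sum_rpow hw).mul_left (2 ^ completeM n * ε ^ (-w.re) * Real.Gamma w.re))
  have hr : 0 < ((completeExponent n k : ℂ) + s).re := lt_of_lt_of_le (by positivity) (h k)
  have hint : ∫ t in Ioi 0, ‖completeTerm n w s k t‖ = |completeCoeff n k| *
      (((completeExponent n k : ℂ) + s).re ^ (-w.re) * Real.Gamma w.re) := by
    rw [Real.rpow_neg hr.le, ← Real.inv_rpow hr.le, ← one_div,
      ← Real.integral_rpow_mul_exp_neg_mul_Ioi hw0 hr, ← integral_const_mul]
    refine setIntegral_congr_fun measurableSet_Ioi fun t ht => ?_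
    rw [completeTerm, norm_mul, norm_cpow_mul_exp_neg_mul _ _ ht, Complex.norm_real,
      Real.norm_eq_abs, neg_mul]
  rw [hint]
  calc _ ≤ 2 ^ completeM n * ((ε * (1 + ∑ j, (k j : ℝ))) ^ (-w.re) * Real.Gamma w.re) := by
        refine mul_le_mul (abs_completeCoeff_le hn k) ?_ (by positivity) (by positivity)
        refine mul_le_mul_of_nonneg_right ?_ hΓ.le
        exact Real.rpow_le_rpow_of_nonpos (by positivity) (h k) (neg_nonpos.mpr hw0.le)
    _ = _ := by
        rw [Real.mul_rpow hε.le (by positivity)]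
        ring

theorem continuousOn_groverZeta_top_exp (hn : 4 ≤ n) (s : ℂ) :
    ContinuousOn (fun t : ℝ => groverZeta (⊤ : SimpleGraph (Fin n)) (Complex.exp t)
      * Complex.exp (-s * t)) (Ioi 0) := by
  simp only [SimpleGraph.groverZeta_top hn]
  intro t ht
  have hx : 1 < Real.exp t := Real.one_lt_exp_iff.mpr ht
  have h1 : Complex.exp t - 1 ≠ 0 := by
    rw [← Complex.ofReal_exp, sub_ne_zero]
    exact_mod_cast hx.ne'
  have h2 : Complex.exp t ^ 2 - 1 ≠ 0 := by
    rw [← Complex.ofReal_exp, sub_ne_zero]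
    exact_mod_cast (one_lt_pow₀ hx two_ne_zero).ne'
  have h3 : Complex.exp t ^ 2 + 2 / ((n : ℂ) - 1) * Complex.exp t + 1 ≠ 0 := by
    have hn' : (4 : ℝ) ≤ n := by exact_mod_cast hn
    have h : 0 < Real.exp t ^ 2 + 2 / ((n : ℝ) - 1) * Real.exp t + 1 := by
      have : 0 ≤ 2 / ((n : ℝ) - 1) := div_nonneg zero_le_two (by linarith)
      positivity
    rw [← Complex.ofReal_exp]
    exact_mod_cast h.ne'
  refine ContinuousAt.continuousWithinAt ?_
  refine ContinuousAt.mul (ContinuousAt.mul (ContinuousAt.mul (ContinuousAt.mul continuousAt_const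
    (continuousAt_const.div (by fun_prop) (pow_ne_zero _ h1)))
    (continuousAt_const.div (by fun_prop) (pow_ne_zero _ h2)))
    (continuousAt_const.div (by fun_prop) (pow_ne_zero _ h3))) (by fun_prop)

theorem meromorphicAt_groverZeta_top_exp (hn : 4 ≤ n) (s : ℂ) :
    MeromorphicAt (fun z : ℂ => groverZeta (⊤ : SimpleGraph (Fin n)) (Complex.exp z)
      * Complex.exp (-s * z)) 0 := by
  simp only [SimpleGraph.groverZeta_top hn]
  have h : MeromorphicAt Complex.exp 0 := AnalyticAt.meromorphicAt (by fun_prop)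
  have h' : MeromorphicAt (fun z => Complex.exp (-s * z)) 0 :=
    AnalyticAt.meromorphicAt (by fun_prop)
  fun_prop

theorem isBigO_groverZeta_top_exp (hn : 4 ≤ n) (s : ℂ) :
    (fun t : ℝ => groverZeta (⊤ : SimpleGraph (Fin n)) (Complex.exp t) * Complex.exp (-s * t))
      =O[atTop] fun t => Real.exp (-((n : ℝ) * ((n : ℝ) - 1) + s.re) * t) := by
  -- The zeta function at `y⁻¹` with its leading power `y^{n(n-1)}` removed; continuity at `y = 0`
  -- makes it bounded as `t → ∞`.
  let H : ℂ → ℂ := fun y => (-1) ^ completeL n * ((1 - y)⁻¹ ^ 2 * (1 - y ^ 2)⁻¹ ^ completeL n *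
    (1 + 2 / ((n : ℂ) - 1) * y + y ^ 2)⁻¹ ^ (n - 1))
  have hH : ContinuousAt H 0 := by
    have h1 : ContinuousAt (fun y : ℂ => (1 - y)⁻¹) 0 :=
      ContinuousAt.inv₀ (by fun_prop) (by simp)
    have h2 : ContinuousAt (fun y : ℂ => (1 - y ^ 2)⁻¹) 0 :=
      ContinuousAt.inv₀ (by fun_prop) (by simp)
    have h3 : ContinuousAt (fun y : ℂ => (1 + 2 / ((n : ℂ) - 1) * y + y ^ 2)⁻¹) 0 :=
      ContinuousAt.inv₀ (by fun_prop) (by simp)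
    exact continuousAt_const.mul (((h1.pow 2).mul (h2.pow _)).mul (h3.pow _))
  have hlim : Tendsto (fun t : ℝ => Complex.exp (-t)) atTop (𝓝 0) := by
    rw [tendsto_zero_iff_norm_tendsto_zero]
    simpa [Complex.norm_exp] using Real.tendsto_exp_neg_atTop_nhds_zero
  have hO : (fun t : ℝ => H (Complex.exp (-t))) =O[atTop] fun _ => (1 : ℝ) :=
    (hH.tendsto.comp hlim).isBigO_one ℝ
  have heq : ∀ t : ℝ, groverZeta (⊤ : SimpleGraph (Fin n)) (Complex.exp t) * Complex.exp (-s * t) =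
      H (Complex.exp (-t)) * Complex.exp (-((n : ℂ) * ((n : ℂ) - 1) + s) * t) := by
    intro t
    have he : Complex.exp (-((n : ℂ) * ((n : ℂ) - 1) + s) * t) =
        Complex.exp (-t) ^ (2 + 2 * completeL n + 2 * (n - 1)) * Complex.exp (-s * t) := by
      have : 2 + 2 * completeL n + 2 * (n - 1) = n * (n - 1) := by
        rw [← two_mul_completeL hn]
        omega
      rw [this, ← Complex.exp_nat_mul, ← Complex.exp_add, Nat.cast_mul,
        Nat.cast_sub (by omega), Nat.cast_one]
      congr 1
      ring
    rw [he, ← inv_inv (Complex.exp t), ← Complex.exp_neg,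
      groverZeta_top_inv hn (Complex.exp_ne_zero _)]
    simp only [H, mul_pow, pow_add, pow_mul]
    ring
  simp_rw [heq]
  have hE : (fun t : ℝ => Complex.exp (-((n : ℂ) * ((n : ℂ) - 1) + s) * t)) =O[atTop]
      fun t : ℝ => Real.exp (-((n : ℝ) * ((n : ℝ) - 1) + s.re) * t) := by
    refine Asymptotics.IsBigO.of_norm_eventuallyLE (Eventually.of_forall fun t => ?_)
    beta_reduce
    rw [Complex.norm_exp]
    refine le_of_eq (congrArg Real.exp ?_)
    simp
  simpa using hO.mul hE

theorem mellinConvergent_groverZeta_top_exp (hn : 4 ≤ n)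
    (hs : -((n : ℝ) * ((n : ℝ) - 1)) < s.re) (hw : (completeM n : ℝ) < w.re) :
    MellinConvergent (fun t : ℝ => groverZeta (⊤ : SimpleGraph (Fin n)) (Real.exp t : ℂ)
      * Complex.exp (-s * t)) w := by
  have hw0 : 0 < w.re := lt_of_le_of_lt (Nat.cast_nonneg _) hw
  refine integrable_tsum_of_summable_integral_norm ?_
    (fun k => ((integral_completeTerm hn hs hw0 k).1.const_mul ((-1 : ℂ) ^ completeL n))) ?_ ?_
  · refine ContinuousOn.aestronglyMeasurable ?_ measurableSet_Ioi
    have hpow : ContinuousOn (fun t : ℝ => (t : ℂ) ^ (w - 1)) (Ioi 0) := fun t ht =>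
      (Complex.continuous_ofReal.continuousAt.cpow continuousAt_const
        (Complex.ofReal_mem_slitPlane.mpr ht)).continuousWithinAt
    simp only [Complex.ofReal_exp]
    exact hpow.smul (continuousOn_groverZeta_top_exp hn s)
  · simpa using summable_integral_norm_completeTerm hn hs hw
  · filter_upwards [ae_restrict_mem measurableSet_Ioi] with t ht
    exact hasSum_completeTerm hn w s ht

theorem summable_completeCoeff_div_cpow (hn : 4 ≤ n)
    (hs : -((n : ℝ) * ((n : ℝ) - 1)) < s.re) (hw : (completeM n : ℝ) < w.re) :
    Summable fun k : Fin (completeM n) → ℕ =>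
      (completeCoeff n k : ℂ) / ((completeExponent n k : ℂ) + s) ^ w := by
  have hw0 : 0 < w.re := lt_of_le_of_lt (Nat.cast_nonneg _) hw
  have h : Summable fun k => ∫ t in Ioi 0, completeTerm n w s k t :=
    (summable_integral_norm_completeTerm hn hs hw).of_norm_bounded
      fun k => norm_integral_le_integral_norm _
  simp_rw [(integral_completeTerm hn hs hw0 _).2] at h
  exact (summable_mul_left_iff (Complex.Gamma_ne_zero_of_re_pos hw0)).mp h

theorem absoluteHurwitzZeta_groverZeta_top (hn : 4 ≤ n)
    (hs : -((n : ℝ) * ((n : ℝ) - 1)) < s.re) (hw : (completeM n : ℝ) < w.re) :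
    absoluteHurwitzZeta (fun x => groverZeta (⊤ : SimpleGraph (Fin n)) (x : ℂ)) w s =
      (-1) ^ completeL n * ∑' k : Fin (completeM n) → ℕ,
        (completeCoeff n k : ℂ) / ((completeExponent n k : ℂ) + s) ^ w := by
  have hw0 : 0 < w.re := lt_of_le_of_lt (Nat.cast_nonneg _) hw
  have h := (hasSum_integral_of_summable_integral_norm
    (fun k => (integral_completeTerm hn hs hw0 k).1.const_mul ((-1 : ℂ) ^ completeL n))
    (by simpa using summable_integral_norm_completeTerm hn hs hw)).tsum_eq
  rw [absoluteHurwitzZeta_eq_mellin, mellin, setIntegral_congr_fun measurableSet_Ioi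
    fun t ht => (hasSum_completeTerm hn w s ht).tsum_eq.symm, ← h]
  simp_rw [integral_const_mul, (integral_completeTerm hn hs hw0 _).2]
  rw [tsum_mul_left, tsum_mul_left]
  have := Complex.Gamma_ne_zero_of_re_pos hw0
  field_simp

theorem exists_continuesToZero_absoluteHurwitzZeta (hn : 4 ≤ n)
    (hs : -((n : ℝ) * ((n : ℝ) - 1)) < s.re) :
    ∃ Φ : ℂ → ℂ, ContinuesToZero (fun w => absoluteHurwitzZeta
      (fun x => groverZeta (⊤ : SimpleGraph (Fin n)) (x : ℂ)) w s) Φ := by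
  simp_rw [absoluteHurwitzZeta_eq_mellin, Complex.ofReal_exp]
  exact Complex.exists_continuesToZero_mellin (meromorphicAt_groverZeta_top_exp hn s)
    (continuousOn_groverZeta_top_exp hn s) (by linarith) (isBigO_groverZeta_top_exp hn s)

end Complete

theorem ContinuesToZero.neg_of_eq_right {F G Φ : ℂ → ℂ} (h : ContinuesToZero F Φ)
    (hFG : ∃ σ : ℝ, ∀ w : ℂ, σ < w.re → G w = -F w) : ContinuesToZero G (-Φ) := by
  obtain ⟨σ, hσ⟩ := h.eq_right
  obtain ⟨τ, hτ⟩ := hFG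
  obtain ⟨ε, hε, hm⟩ := h.meromorphic
  refine ⟨⟨max σ τ, fun w hw => ?_⟩, ⟨ε, hε, fun w hw => (hm w hw).neg⟩, h.analyticAt_zero.neg⟩
  rw [Pi.neg_apply, hσ w ((le_max_left _ _).trans_lt hw), hτ w ((le_max_right _ _).trans_lt hw)]

end CompleteGraphZeta

theorem proposition3 (n : ℕ) (hn : 4 ≤ n) :
    (∀ u : ℂ, groverZeta (⊤ : SimpleGraph (Fin n)) u =
      (-1) ^ completeL n * (1 / (u - 1) ^ 2) * (1 / (u ^ 2 - 1) ^ completeL n)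
        * (1 / (u ^ 2 + 2 / ((n : ℂ) - 1) * u + 1) ^ (n - 1))) ∧
    ∀ s : ℂ, -((n : ℝ) * ((n : ℝ) - 1)) < s.re →
      (∀ w : ℂ, (completeM n : ℝ) < w.re →
        MeasureTheory.IntegrableOn
          (absoluteHurwitzIntegrand (fun x => groverZeta (⊤ : SimpleGraph (Fin n)) (x : ℂ)) w s)
          (Set.Ioi (1 : ℝ)) ∧
        Summable (fun k : Fin (completeM n) → ℕ =>
          (completeCoeff n k : ℂ) / ((completeExponent n k : ℂ) + s) ^ w) ∧
        absoluteHurwitzZeta (fun x => groverZeta (⊤ : SimpleGraph (Fin n)) (x : ℂ)) w s =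
          (-1) ^ completeL n * ∑' k : Fin (completeM n) → ℕ,
            (completeCoeff n k : ℂ) / ((completeExponent n k : ℂ) + s) ^ w) ∧
      (∃ Φ : ℂ → ℂ, ContinuesToZero
        (fun w => absoluteHurwitzZeta
          (fun x => groverZeta (⊤ : SimpleGraph (Fin n)) (x : ℂ)) w s) Φ) ∧
      absoluteZeta (fun x => groverZeta (⊤ : SimpleGraph (Fin n)) (x : ℂ)) s =
        zetaRegularizedProd
          (fun k : Fin (completeM n) → ℕ => (completeExponent n k : ℂ) + s)
          (fun k => -((-1) ^ completeL n * (completeCoeff n k : ℂ))) := by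
  refine ⟨SimpleGraph.groverZeta_top hn, fun s hs => ⟨fun w hw => ⟨?_, ?_, ?_⟩, ?_, ?_⟩⟩
  · exact (integrableOn_absoluteHurwitzIntegrand_iff _ w s).mpr
      (mellinConvergent_groverZeta_top_exp hn hs hw)
  · exact summable_completeCoeff_div_cpow hn hs hw
  · exact absoluteHurwitzZeta_groverZeta_top hn hs hw
  · exact exists_continuesToZero_absoluteHurwitzZeta hn hs
  · obtain ⟨Φ, hΦ⟩ := exists_continuesToZero_absoluteHurwitzZeta hn hs
    -- The product's exponents are `-(-1)^L a(k)`, so its Dirichlet series is `-Z_f`; the minus sign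
    -- in the regularized product undoes this.
    have hneg : ContinuesToZero (fun w => ∑' k : Fin (completeM n) → ℕ,
        -((-1) ^ completeL n * (completeCoeff n k : ℂ)) *
          ((completeExponent n k : ℂ) + s) ^ (-w)) (-Φ) := by
      refine hΦ.neg_of_eq_right ⟨completeM n, fun w hw => ?_⟩
      rw [absoluteHurwitzZeta_groverZeta_top hn hs hw, ← tsum_mul_left, ← tsum_neg]
      refine tsum_congr fun k => ?_
      rw [Complex.cpow_neg]
      ring
    rw [absoluteZeta, zetaRegularizedProd, hΦ.continuedDerivAtZero_eq,
      hneg.continuedDerivAtZero_eq, deriv.neg, neg_neg]
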